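/- All vector spaces are over $\mathbb{C}$. For a vector space $M$ and a formal series $f=\sum_{m\in\mathbb{Z}}u_m x^{-m-1}$ put $\mathrm{Sing}\,f=\sum_{m\ge 0}u_m x^{-m-1}$, and similarly in several variables. A *1-truncated conformal algebra* is a graded vector space $\mathbb{A}\oplus\mathbb{B}$ ($\mathbb{A}$ in degree $0$, $\mathbb{B}$ in degree $1$) with a linear map $\partial:\mathbb{A}\to\mathbb{B}$ and bilinear operations $(u,v)\mapsto u_iv$ of degree $-i-1$, $i=0,1$, such that for $a\in\mathbb{A}$, $u,v\in\mathbb{B}$, $\alpha,\beta,\gamma\in\mathbb{A}\oplus\mathbb{B}$, $i=0,1$: $(\partial a)_0=0$, $(\partial a)_1=-a_0$, $\partial(u_0a)=u_0\partial a$; $u_0a=-a_0u$, $u_0v=-v_0u+\partial(v_1u)$, $u_1v=v_1u$; $\alpha_0\beta_i\gamma=\beta_i\alpha_0\gamma+(\alpha_0\beta)_i\gamma$. A *vertex Lie algebra* is a vector space $M$ with a linear operator $T$ and a linear map $Y_-:M\to\mathrm{Hom}(M,x^{-1}M[x^{-1}])$ such that $Y_-(Ta,x)=\frac{d}{dx}Y_-(a,x)$,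 $Y_-(a,x)b=\mathrm{Sing}(e^{xT}Y_-(b,-x)a)$ and $[Y_-(a,x_1),Y_-(b,x_2)]=\mathrm{Sing}(Y_-(Y_-(a,x_1-x_2)b,x_2))$ for $a,b\in M$, where negative powers of $x_1-x_2$ are expanded in nonnegative powers of $x_2$. A *vertex Poisson algebra* is a commutative associative unital algebra with a derivation $T$ and a vertex Lie algebra structure $(Y_-,T)$ such that $Y_-(a,x)(bc)=(Y_-(a,x)b)c+b(Y_-(a,x)c)$. Let $(\mathbb{A}\oplus\mathbb{B},\partial)$ be a 1-truncated conformal algebra. Let $C(\mathbb{A}\oplus\mathbb{B})=\mathbb{C}[\mathcal{D}]\otimes(\mathbb{A}\oplus\mathbb{B})$, $C(\mathbb{A})=\mathbb{C}[\mathcal{D}]\otimes\mathbb{A}$, let $\mathcal{D}$ also denote multiplication by $\mathcal{D}$ on the left factor, and put $\hat\partial=1\otimes\partial-\mathcal{D}\otimes1:C(\mathbb{A})\to C(\mathbb{A}\oplus\mathbb{B})$. Identify $u\in\mathbb{A}\oplus\mathbb{B}$ with $1\otimes u$. Define a linear map $Y^0_-:C(\mathbb{A}\oplus\mathbb{B})\to\mathrm{Hom}(C(\mathbb{A}\oplus\mathbb{B}),x^{-1}C(\mathbb{A}\oplus\mathbb{B})[x^{-1}])$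 by the following formulas, for $a,a'\in\mathbb{A}$, $b,b'\in\mathbb{B}$, $u,v\in\mathbb{A}\oplus\mathbb{B}$: $$Y^0_-(a,x)a'=0,\quad Y^0_-(a,x)b=a_0b\,x^{-1},\quad Y^0_-(b,x)a=b_0a\,x^{-1},\quad Y^0_-(b,x)b'=b_0b'\,x^{-1}+b_1b'\,x^{-2},$$ $$Y^0_-(u,x)(\mathcal{D}^n\otimes v)=\sum_{i=0}^n\binom{n}{i}(-1)^{n-i}\mathcal{D}^i\left(\tfrac{d}{dx}\right)^{n-i}Y^0_-(u,x)v\qquad(n\ge0),$$ $$Y^0_-(\mathcal{D}^n\otimes u,x)(\mathcal{D}^m\otimes v)=\mathrm{Sing}\left(e^{x\mathcal{D}}\left(-\tfrac{d}{dx}\right)^mY^0_-(v,-x)(\mathcal{D}^n\otimes u)\right)\qquad(n\ge1,\ m\ge0).$$ Let $\mathcal{C}=C(\mathbb{A}\oplus\mathbb{B})/\hat\partial C(\mathbb{A})$. Then $\mathcal{D}$ and $Y^0_-$ descend to $\mathcal{C}$, and $(\mathcal{C},Y^0_-,\mathcal{D})$ is a vertex Lie algebra. Let $S(\mathcal{C})$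 be the symmetric algebra and extend $\mathcal{D}$ to a derivation of $S(\mathcal{C})$. For each $u\in\mathcal{C}$ there is a unique $\widetilde{Y^0_-}(u,x)\in x^{-1}(\mathrm{Der}\,S(\mathcal{C}))[[x^{-1}]]$ with $\widetilde{Y^0_-}(u,x)v=Y^0_-(u,x)v$ for all $v\in\mathcal{C}$; it maps $S(\mathcal{C})$ into $x^{-1}S(\mathcal{C})[x^{-1}]$. There is a unique vertex Poisson algebra structure $Y_-$ on $(S(\mathcal{C}),\mathcal{D})$ that extends $Y^0_-$, and for $a\in S(\mathcal{C})$ the coefficients of $Y_-(a,x)$ are the derivations of $S(\mathcal{C})$ determined by $$Y_-(a,x)u=\mathrm{Sing}\left(e^{x\mathcal{D}}\,\widetilde{Y^0_-}(u,-x)a\right)\qquad(u\in\mathcal{C}).$$ -/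

import Mathlib

open scoped TensorProduct Polynomial

noncomputable section

namespace VertexLie

/-! ## Singular formal series -/

/-- The space `x⁻¹ M[x⁻¹]`: the finitely supported function `f : ℕ →₀ M` stands for
`∑ n, f n * x ^ (-n-1)`. -/
abbrev Polar (M : Type*) [AddCommGroup M] : Type _ := ℕ →₀ M

section Polar

variable {M N : Type*} [AddCommGroup M] [Module ℂ M] [AddCommGroup N] [Module ℂ N]

/-- The operation `d/dx`, i.e. `m x ^ (-n-1) ↦ -(n+1) m x ^ (-(n+1)-1)`. -/
def ddx : Polar M →ₗ[ℂ] Polar M :=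
  Finsupp.lsum ℂ fun n => (-((n : ℂ) + 1)) • Finsupp.lsingle (n + 1)

/-- The substitution `x ↦ -x`, i.e. `m x ^ (-n-1) ↦ (-1) ^ (n+1) m x ^ (-n-1)`. -/
def negx : Polar M →ₗ[ℂ] Polar M :=
  Finsupp.lsum ℂ fun n => ((-1 : ℂ) ^ (n + 1)) • Finsupp.lsingle n

/-- The operation `f ↦ Sing (e ^ (x T) f)`: on `m x ^ (-n-1)`, the terms
`(1 / i!) T^i m x ^ (i-n-1)` with `i ≤ n` are kept. -/
def singExp (T : Module.End ℂ M) : Polar M →ₗ[ℂ] Polar M :=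
  Finsupp.lsum ℂ fun n => ∑ i ∈ Finset.range (n + 1),
    (1 / (i.factorial : ℂ)) • (Finsupp.lsingle (n - i) ∘ₗ (T ^ i))

theorem ddx_single (n : ℕ) (m : M) :
    ddx (Finsupp.single n m) = Finsupp.single (n + 1) ((-((n : ℂ) + 1)) • m) := by
  simp only [ddx, Finsupp.lsum_single, LinearMap.smul_apply, Finsupp.lsingle_apply,
    Finsupp.smul_single]

theorem negx_single (n : ℕ) (m : M) :
    negx (Finsupp.single n m) = Finsupp.single n ((-1 : ℂ) ^ (n + 1) • m) := by
  simp only [negx, Finsupp.lsum_single, LinearMap.smul_apply, Finsupp.lsingle_apply,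
    Finsupp.smul_single]

theorem singExp_single (T : Module.End ℂ M) (n : ℕ) (m : M) :
    singExp T (Finsupp.single n m) = ∑ i ∈ Finset.range (n + 1),
      Finsupp.single (n - i) ((1 / (i.factorial : ℂ)) • (T ^ i) m) := by
  simp only [singExp, Finsupp.lsum_single, LinearMap.sum_apply, LinearMap.smul_apply,
    LinearMap.comp_apply, Finsupp.lsingle_apply, Finsupp.smul_single]

/-- A linear map applied to each coefficient. -/
def mapPolar (T : M →ₗ[ℂ] N) : Polar M →ₗ[ℂ] Polar N := Finsupp.mapRange.linearMap T

end Polar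

/-! ## Vertex Lie algebras and vertex Poisson algebras -/

/-- `(M, Y, T)` is a vertex Lie algebra. Here `Y a b` stands for `Y₋(a, x) b` and `Y a b n`
for `a_n b`; that `a_n b = 0` for large `n` is part of the type of `Y`. -/
structure IsVertexLieAlgebra {M : Type*} [AddCommGroup M] [Module ℂ M]
    (T : Module.End ℂ M) (Y : M →ₗ[ℂ] M →ₗ[ℂ] Polar M) : Prop where
  /-- `Y₋(T a, x) = d/dx Y₋(a, x)` -/
  derivative : ∀ a b, Y (T a) b = ddx (Y a b)
  /-- Half skew symmetry: `Y₋(a, x) b = Sing (e ^ (x T) Y₋(b, -x) a)` -/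
  half_skew : ∀ a b, Y a b = singExp T (negx (Y b a))
  /-- The half commutator formula `[Y₋(a, x₁), Y₋(b, x₂)] = Sing (Y₋(Y₋(a, x₁ - x₂) b, x₂))`,
  as the equality of the coefficients of `x₁ ^ (-m-1) x₂ ^ (-n-1)`. -/
  half_commutator : ∀ a b c m n, Y a (Y b c n) m - Y b (Y a c m) n =
    ∑ i ∈ Finset.range (m + 1), (m.choose i : ℂ) • Y (Y a b i) c (m + n - i)

/-- `(S, T, Y)` is a vertex Poisson algebra: `(S, T)` is a differential algebra with a vertex
Lie algebra structure `Y` for which all `a_n` are derivations of the product. -/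
structure IsVertexPoissonAlgebra {S : Type*} [CommRing S] [Algebra ℂ S]
    (T : Derivation ℂ S S) (Y : S →ₗ[ℂ] S →ₗ[ℂ] Polar S) : Prop where
  vertexLie : IsVertexLieAlgebra (T : S →ₗ[ℂ] S) Y
  leibniz : ∀ a b c n, Y a (b * c) n = Y a b n * c + b * Y a c n

/-! ## Derivations of a symmetric algebra -/

section Derivations

variable {M : Type*} [AddCommGroup M] [Module ℂ M]
  {N : Type*} [AddCommGroup N] [Module ℂ N] [Module (SymmetricAlgebra ℂ M) N]
  [Module (SymmetricAlgebra ℂ M)ᵐᵒᵖ N] [IsCentralScalar (SymmetricAlgebra ℂ M) N]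
  [IsScalarTower ℂ (SymmetricAlgebra ℂ M) N]
  [IsScalarTower ℂ (SymmetricAlgebra ℂ M)ᵐᵒᵖ N]

/-- Auxiliary algebra homomorphism `s ↦ (s, extendDer f s)` into the square-zero extension. -/
def extendDerAux (f : M →ₗ[ℂ] N) :
    SymmetricAlgebra ℂ M →ₐ[ℂ] TrivSqZeroExt (SymmetricAlgebra ℂ M) N :=
  SymmetricAlgebra.lift
    ((TrivSqZeroExt.inlAlgHom ℂ (SymmetricAlgebra ℂ M) N).toLinearMap ∘ₗ SymmetricAlgebra.ι ℂ M +
      (TrivSqZeroExt.inrHom (SymmetricAlgebra ℂ M) N).restrictScalars ℂ ∘ₗ f)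

theorem extendDerAux_fst (f : M →ₗ[ℂ] N) (s : SymmetricAlgebra ℂ M) :
    (extendDerAux f s).fst = s := by
  have : (TrivSqZeroExt.fstHom ℂ (SymmetricAlgebra ℂ M) N).comp (extendDerAux f) =
      AlgHom.id ℂ _ := by
    apply SymmetricAlgebra.algHom_ext
    ext m
    simp [extendDerAux]
  exact DFunLike.congr_fun this s

/-- The derivation of the symmetric algebra with values in the module `N` that extends the
linear map `f` on generators. -/
def extendDer (f : M →ₗ[ℂ] N) : Derivation ℂ (SymmetricAlgebra ℂ M) N :=
  Derivation.mk'
    { toFun := fun s => (extendDerAux f s).snd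
      map_add' := by simp
      map_smul' := by simp }
    (by
      intro a b
      simp [TrivSqZeroExt.snd_mul, extendDerAux_fst])

theorem extendDer_ι (f : M →ₗ[ℂ] N) (m : M) :
    extendDer f (SymmetricAlgebra.ι ℂ M m) = f m := by
  change (extendDerAux f (SymmetricAlgebra.ι ℂ M m)).snd = f m
  simp [extendDerAux]

end Derivations

section SymmetricAlgebra

variable {M : Type*} [AddCommGroup M] [Module ℂ M]

/-- The derivation of `S(M)` that extends the linear operator `T` on `M`. -/
def symDer (T : Module.End ℂ M) : Derivation ℂ (SymmetricAlgebra ℂ M) (SymmetricAlgebra ℂ M) :=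
  extendDer (SymmetricAlgebra.ι ℂ M ∘ₗ T)

theorem symDer_ι (T : Module.End ℂ M) (m : M) :
    symDer T (SymmetricAlgebra.ι ℂ M m) = SymmetricAlgebra.ι ℂ M (T m) :=
  extendDer_ι _ _

/-- The series `Ỹ(u, x)` of derivations of `S(M)` that extends `Y(u, x)`. It is written as one
derivation `S(M) → x⁻¹ S(M)[x⁻¹]`; its coefficients are derivations of `S(M)`. -/
def tildeY (Y : M →ₗ[ℂ] M →ₗ[ℂ] Polar M) (u : M) :
    Derivation ℂ (SymmetricAlgebra ℂ M) (Polar (SymmetricAlgebra ℂ M)) :=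
  extendDer (mapPolar (SymmetricAlgebra.ι ℂ M) ∘ₗ Y u)

theorem tildeY_ι (Y : M →ₗ[ℂ] M →ₗ[ℂ] Polar M) (u v : M) :
    tildeY Y u (SymmetricAlgebra.ι ℂ M v) = mapPolar (SymmetricAlgebra.ι ℂ M) (Y u v) :=
  extendDer_ι _ _

/-- `Z` on `S(M)` extends `Y` on `M`. -/
def Extends (Z : SymmetricAlgebra ℂ M →ₗ[ℂ] SymmetricAlgebra ℂ M →ₗ[ℂ]
      Polar (SymmetricAlgebra ℂ M)) (Y : M →ₗ[ℂ] M →ₗ[ℂ] Polar M) : Prop :=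
  ∀ u v, Z (SymmetricAlgebra.ι ℂ M u) (SymmetricAlgebra.ι ℂ M v) =
    mapPolar (SymmetricAlgebra.ι ℂ M) (Y u v)

end SymmetricAlgebra

/-! ## Linear maps out of `ℂ[𝒟] ⊗ W` -/

section LinExt

variable {W N : Type*} [AddCommGroup W] [Module ℂ W] [AddCommGroup N] [Module ℂ N]

/-- The linear map on `ℂ[𝒟] ⊗ W` with `𝒟 ^ n ⊗ w ↦ f n w`. -/
def linExt : (ℕ → W →ₗ[ℂ] N) →ₗ[ℂ] (ℂ[X] ⊗[ℂ] W →ₗ[ℂ] N) :=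
  (TensorProduct.lift.equiv (RingHom.id ℂ) ℂ[X] W N).toLinearMap ∘ₗ
    ((Polynomial.basisMonomials ℂ).constr ℂ).toLinearMap

theorem linExt_apply (f : ℕ → W →ₗ[ℂ] N) (n : ℕ) (w : W) :
    linExt f ((Polynomial.X ^ n : ℂ[X]) ⊗ₜ[ℂ] w) = f n w := by
  have h : (Polynomial.X ^ n : ℂ[X]) = Polynomial.basisMonomials ℂ n := by
    simp [Polynomial.coe_basisMonomials, Polynomial.X_pow_eq_monomial]
  rw [h]
  simp only [linExt, LinearMap.comp_apply, LinearEquiv.coe_coe, TensorProduct.lift.equiv_apply,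
    Module.Basis.constr_basis]

/-- The inclusion `w ↦ 𝒟 ^ n ⊗ w`. -/
def monom (n : ℕ) : W →ₗ[ℂ] ℂ[X] ⊗[ℂ] W := TensorProduct.mk ℂ ℂ[X] W (Polynomial.X ^ n)

/-- Multiplication by the formal variable `𝒟`, acting on the left factor of `ℂ[𝒟] ⊗ W`. -/
def opD (W : Type*) [AddCommGroup W] [Module ℂ W] : Module.End ℂ (ℂ[X] ⊗[ℂ] W) :=
  (LinearMap.mulLeft ℂ (Polynomial.X : ℂ[X])).rTensor W

end LinExt

/-! ## 1-truncated conformal algebras -/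

/-- The homogeneous subspaces of `A ⊕ B`, where `A` has degree `0` and `B` has degree `1`. -/
def gr (A B : Type*) [AddCommGroup A] [Module ℂ A] [AddCommGroup B] [Module ℂ B] (n : ℤ) :
    Submodule ℂ (A × B) :=
  if n = 0 then LinearMap.range (LinearMap.inl ℂ A B)
  else if n = 1 then LinearMap.range (LinearMap.inr ℂ A B)
  else ⊥

/-- A 1-truncated conformal algebra structure on the graded space `A ⊕ B`.
`mul i u v` is `u_i v`; `(a, 0)` and `(0, u)` are the elements `a` of `A` and `u` of `B`. -/
structure OneTruncatedConformalAlgebra (A B : Type*) [AddCommGroup A] [Module ℂ A]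
    [AddCommGroup B] [Module ℂ B] where
  /-- the map `∂ : A → B` -/
  d : A →ₗ[ℂ] B
  /-- the products `u_0 v` and `u_1 v` -/
  mul : Fin 2 → (A × B) →ₗ[ℂ] (A × B) →ₗ[ℂ] (A × B)
  /-- the product `u_i v` has degree `-i-1` -/
  degree : ∀ (i : Fin 2) (m n : ℤ), ∀ u ∈ gr A B m, ∀ v ∈ gr A B n,
    mul i u v ∈ gr A B (m + n - ((i : ℕ) : ℤ) - 1)
  d_mul_zero : ∀ a, mul 0 (0, d a) = 0
  d_mul_one : ∀ a, mul 1 (0, d a) = -mul 0 (a, 0)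
  d_comm : ∀ (a : A) (u : B), ((0, d (mul 0 (0, u) (a, 0)).1) : A × B) = mul 0 (0, u) (0, d a)
  comm_zero : ∀ (a : A) (u : B), mul 0 (0, u) (a, 0) = -mul 0 (a, 0) (0, u)
  skew_zero : ∀ u v : B, mul 0 (0, u) (0, v) =
    -mul 0 (0, v) (0, u) + (0, d (mul 1 (0, v) (0, u)).1)
  symm_one : ∀ u v : B, mul 1 (0, u) (0, v) = mul 1 (0, v) (0, u)
  assoc : ∀ (i : Fin 2) (α β γ : A × B),
    mul 0 α (mul i β γ) = mul i β (mul 0 α γ) + mul i (mul 0 α β) γ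

namespace OneTruncatedConformalAlgebra

variable {A B : Type*} [AddCommGroup A] [Module ℂ A] [AddCommGroup B] [Module ℂ B]
  (V : OneTruncatedConformalAlgebra A B)

/-- `C(A ⊕ B) = ℂ[𝒟] ⊗ (A ⊕ B)`. -/
abbrev FreeC (_V : OneTruncatedConformalAlgebra A B) : Type _ := ℂ[X] ⊗[ℂ] (A × B)

/-- `1 ⊗ ∂ - 𝒟 ⊗ 1 : C(A) → C(A ⊕ B)`. -/
def dHat : ℂ[X] ⊗[ℂ] A →ₗ[ℂ] V.FreeC :=
  (LinearMap.inr ℂ A B ∘ₗ V.d).lTensor ℂ[X] - (LinearMap.inl ℂ A B).lTensor ℂ[X] ∘ₗ opD A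

/-- The series `Y(u, x) v = (1 ⊗ u_0 v) x⁻¹ + (1 ⊗ u_1 v) x⁻²` for `u, v ∈ A ⊕ B`. By the degree
condition it is `0` on `A × A`, and only the term in `x⁻¹` is left on `A × B` and `B × A`. -/
def baseY : (A × B) →ₗ[ℂ] (A × B) →ₗ[ℂ] Polar V.FreeC :=
  (V.mul 0).compr₂ (Finsupp.lsingle 0 ∘ₗ monom 0) +
    (V.mul 1).compr₂ (Finsupp.lsingle 1 ∘ₗ monom 0)

/-- The series `Y(u, x) (𝒟 ^ n ⊗ v)` for `u, v ∈ A ⊕ B`, given by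
`∑_{i ≤ n} (n choose i) (-1) ^ (n-i) 𝒟 ^ i (d/dx) ^ (n-i) Y(u, x) v`; equivalently
`Y(u, x) e ^ (x₁ 𝒟) v = e ^ (x₁ 𝒟) e ^ (-x₁ d/dx) Y(u, x) v`. -/
def genY : (A × B) →ₗ[ℂ] V.FreeC →ₗ[ℂ] Polar V.FreeC :=
  linExt ∘ₗ LinearMap.pi fun n =>
    LinearMap.compRight ℂ (∑ i ∈ Finset.range (n + 1),
      ((n.choose i : ℂ) * (-1) ^ (n - i)) • (mapPolar (opD (A × B) ^ i) ∘ₗ (ddx ^ (n - i)))) ∘ₗ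
    V.baseY

theorem genY_apply (u v : A × B) (n : ℕ) :
    V.genY u ((Polynomial.X ^ n : ℂ[X]) ⊗ₜ[ℂ] v) = ∑ i ∈ Finset.range (n + 1),
      ((n.choose i : ℂ) * (-1) ^ (n - i)) •
        mapPolar (opD (A × B) ^ i) (((ddx ^ (n - i) : Module.End ℂ (Polar V.FreeC))) (V.baseY u v)) := by
  simp [genY, linExt_apply]

/-- The map `u ↦ (𝒟 ^ m ⊗ v ↦ Sing (e ^ (x 𝒟) (-d/dx) ^ m Y(v, -x) (𝒟 ^ n ⊗ u)))`. -/
def skewY (n : ℕ) : (A × B) →ₗ[ℂ] V.FreeC →ₗ[ℂ] Polar V.FreeC :=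
  linExt ∘ₗ LinearMap.pi fun m =>
    LinearMap.compRight ℂ (singExp (opD (A × B)) ∘ₗ ((-ddx) ^ m : Module.End ℂ (Polar V.FreeC)) ∘ₗ negx) ∘ₗ
    V.genY.flip ∘ₗ monom n

theorem skewY_apply (u v : A × B) (n m : ℕ) :
    V.skewY n u ((Polynomial.X ^ m : ℂ[X]) ⊗ₜ[ℂ] v) =
      singExp (opD (A × B)) (((-ddx) ^ m : Module.End ℂ (Polar V.FreeC)) (negx (V.genY v ((Polynomial.X ^ n : ℂ[X]) ⊗ₜ[ℂ] u)))) := by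
  simp [skewY, linExt_apply, monom]

/-- The map `Y⁰₋` on `C(A ⊕ B)`. -/
def freeY : V.FreeC →ₗ[ℂ] V.FreeC →ₗ[ℂ] Polar V.FreeC :=
  linExt fun n => if n = 0 then V.genY else V.skewY n

theorem freeY_zero (u : A × B) :
    V.freeY ((1 : ℂ[X]) ⊗ₜ[ℂ] u) = V.genY u := by
  rw [← pow_zero (Polynomial.X : ℂ[X]), freeY, linExt_apply, if_pos rfl]

theorem freeY_pos (n : ℕ) (hn : 1 ≤ n) (u : A × B) :
    V.freeY ((Polynomial.X ^ n : ℂ[X]) ⊗ₜ[ℂ] u) = V.skewY n u := by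
  rw [freeY, linExt_apply, if_neg (by omega)]

/-- `𝒞 = C(A ⊕ B) / ∂̂ C(A)`. -/
abbrev QuotC : Type _ := V.FreeC ⧸ LinearMap.range V.dHat

/-- The projection `ρ : C(A ⊕ B) → 𝒞`. -/
abbrev proj : V.FreeC →ₗ[ℂ] V.QuotC := (LinearMap.range V.dHat).mkQ

theorem opD_mem : LinearMap.range V.dHat ≤ (LinearMap.range V.dHat).comap (opD (A × B)) := by
  have h : opD (A × B) ∘ₗ V.dHat = V.dHat ∘ₗ opD A := by
    apply TensorProduct.ext'
    intro p a
    simp [dHat, opD]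
  rintro _ ⟨c, rfl⟩
  exact ⟨opD A c, (LinearMap.congr_fun h c).symm⟩

/-- The operator on `𝒞` induced by `𝒟`. -/
def quotD : Module.End ℂ V.QuotC := Submodule.mapQ _ _ (opD (A × B)) V.opD_mem

end OneTruncatedConformalAlgebra

end VertexLie

end

/-!
The argument runs through the formal Laplace transform: the series `∑ n, f n * x ^ (-n-1)` is read
as the polynomial `∑ n, λ ^ n / n! * f n`. Then `d/dx` becomes `-λ`, the operation
`Sing (e ^ (x T) f(-x))` becomes the substitution `λ ↦ -λ - T` with a sign (`evalAt_skew`), and the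
half commutator formula becomes the Jacobi identity of Lie conformal algebras
`[a_z [b_w c]] - [b_w [a_z c]] = [[a_z b]_{z+w} c]` (`jacobi_iff`). As a polynomial over `ℂ` is
determined by its values (`polar_ext`), `z` and `w` are complex numbers throughout, and operators
that commute with `T` are substituted where skew symmetry requires it.

The Jacobi identity is invariant under permutations of its three arguments, by skew symmetry
(`Jacobi.swap_left`, `Jacobi.swap_right`). Hence it suffices to check it on generators, once it is
known to propagate in the last argument alone (`isVertexLieAlgebra_of_generators`).

* On `𝒞` it propagates along `T`. Modulo `∂̂ C(A)` the series `Y⁰₋(𝒟ⁿ ⊗ u, x) (𝒟ᵐ ⊗ v)` has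
  the transform `(-λ)ⁿ (λ + 𝒟)ᵐ (u_0 v + λ u_1 v)` (`evalNum_projY`). This gives skew symmetry and
  the descent to `𝒞`, and on generators the Jacobi identity is an identity in `A ⊕ B`.
* On `S(𝒞)` it propagates along products, as the coefficients of `Y₋(a, x)` are derivations. The
  remaining point is skew symmetry, which says that `Y₋(a, x) b` also satisfies a Leibniz rule in
  `a`, twisted by `e ^ (x 𝒟)` (`symY_mul_left`). This holds on generators by definition, and both
  sides are derivations in the right argument because twisted and ordinary multiplications commute
  (`twistedMul_smul`).

Uniqueness holds because a derivation is determined by its values on generators: `Y₋(u, x)` is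
forced for `u ∈ 𝒞`, then `Y₋(a, x) u` by skew symmetry, then `Y₋(a, x)`.
-/

open scoped TensorProduct Polynomial

noncomputable section

namespace VertexLie

/-! ### The Laplace transform of singular series -/

section Evaluation

variable {M N : Type*} [AddCommGroup M] [Module ℂ M] [AddCommGroup N] [Module ℂ N]

/-- The value of a singular series at an operator. The series `∑ n, f n * x ^ (-n-1)` is read as
the polynomial `∑ n, λ ^ n / n! * f n` (its formal Laplace transform), and the operator `P` is
substituted for `λ`. -/
def evalAt (P : Module.End ℂ M) : Polar M →ₗ[ℂ] M :=
  Finsupp.lsum ℂ fun n => (1 / (n.factorial : ℂ)) • P ^ n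

theorem evalAt_single (P : Module.End ℂ M) (n : ℕ) (m : M) :
    evalAt P (Finsupp.single n m) = (1 / (n.factorial : ℂ)) • (P ^ n) m := by
  simp [evalAt]

/-- The value of a singular series at a complex number. -/
abbrev evalNum (z : ℂ) : Polar M →ₗ[ℂ] M := evalAt (algebraMap ℂ (Module.End ℂ M) z)

theorem evalAt_ddx (P : Module.End ℂ M) (f : Polar M) :
    evalAt P (ddx f) = -P (evalAt P f) := by
  induction f using Finsupp.induction_linear with
  | zero => simp
  | add f g hf hg => simp only [map_add, hf, hg, neg_add]
  | single n m =>
    rw [ddx_single, evalAt_single, evalAt_single, map_smul, map_smul, smul_smul, pow_succ',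
      Module.End.mul_apply, ← neg_smul, Nat.factorial_succ]
    congr 1
    push_cast
    have : (n.factorial : ℂ) ≠ 0 := by exact_mod_cast n.factorial_ne_zero
    have : (n : ℂ) + 1 ≠ 0 := by exact_mod_cast n.succ_ne_zero
    field_simp

theorem evalAt_ddx_pow (P : Module.End ℂ M) (k : ℕ) (f : Polar M) :
    evalAt P ((ddx ^ k : Module.End ℂ (Polar M)) f) = ((-P) ^ k) (evalAt P f) := by
  induction k with
  | zero => simp
  | succ k ih =>
    rw [pow_succ', pow_succ', Module.End.mul_apply, Module.End.mul_apply, evalAt_ddx, ih]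
    rfl

theorem evalAt_neg_ddx_pow (P : Module.End ℂ M) (k : ℕ) (f : Polar M) :
    evalAt P (((-ddx) ^ k : Module.End ℂ (Polar M)) f) = (P ^ k) (evalAt P f) := by
  induction k with
  | zero => simp
  | succ k ih =>
    rw [pow_succ', pow_succ', Module.End.mul_apply, Module.End.mul_apply, LinearMap.neg_apply,
      map_neg, evalAt_ddx, ih, neg_neg]

theorem neg_pow_eq_smul (P : Module.End ℂ M) (n : ℕ) : (-P) ^ n = ((-1 : ℂ) ^ n) • P ^ n := by
  rw [← smul_pow, neg_one_smul]

theorem evalAt_negx (P : Module.End ℂ M) (f : Polar M) :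
    evalAt P (negx f) = -evalAt (-P) f := by
  induction f using Finsupp.induction_linear with
  | zero => simp
  | add f g hf hg => simp only [map_add, hf, hg, neg_add]
  | single n m =>
    rw [negx_single, evalAt_single, evalAt_single, neg_pow_eq_smul, map_smul,
      LinearMap.smul_apply, pow_succ, smul_smul, smul_smul, ← neg_smul]
    congr 1
    ring

/-- Under the Laplace transform `Sing ∘ e ^ (x T)` becomes the shift `λ ↦ λ + T`. -/
theorem evalAt_singExp {P T : Module.End ℂ M} (h : Commute P T) (f : Polar M) :
    evalAt P (singExp T f) = evalAt (P + T) f := by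
  induction f using Finsupp.induction_linear with
  | zero => simp
  | add f g hf hg => simp only [map_add, hf, hg]
  | single n m =>
    rw [singExp_single, evalAt_single, add_comm P T, h.symm.add_pow, map_sum, LinearMap.sum_apply,
      Finset.smul_sum]
    refine Finset.sum_congr rfl fun i hi => ?_
    have hi' : i ≤ n := by simpa [Nat.lt_succ_iff] using hi
    rw [evalAt_single, map_smul, smul_smul, (h.symm.pow_pow i (n - i)).eq, ← nsmul_eq_mul',
      LinearMap.smul_apply, ← Nat.cast_smul_eq_nsmul ℂ, smul_smul, Module.End.mul_apply,
      Nat.cast_choose ℂ hi']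
    congr 1
    have h1 : (n.factorial : ℂ) ≠ 0 := by exact_mod_cast n.factorial_ne_zero
    have h2 : (i.factorial : ℂ) ≠ 0 := by exact_mod_cast i.factorial_ne_zero
    have h3 : ((n - i).factorial : ℂ) ≠ 0 := by exact_mod_cast (n - i).factorial_ne_zero
    field_simp

theorem evalAt_skew {P T : Module.End ℂ M} (h : Commute P T) (f : Polar M) :
    evalAt P (singExp T (negx f)) = -evalAt (-(P + T)) f := by
  rw [evalAt_singExp h, evalAt_negx]

theorem evalAt_mapPolar {P : Module.End ℂ M} {Q : Module.End ℂ N} (g : M →ₗ[ℂ] N)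
    (h : ∀ m, Q (g m) = g (P m)) (f : Polar M) :
    evalAt Q (mapPolar g f) = g (evalAt P f) := by
  induction f using Finsupp.induction_linear with
  | zero => simp
  | add f g hf hg => simp only [map_add, hf, hg]
  | single n m =>
    have hp : ∀ n m, (Q ^ n) (g m) = g ((P ^ n) m) := by
      intro n
      induction n with
      | zero => simp
      | succ n ih => intro m; rw [pow_succ, pow_succ, Module.End.mul_apply, h, ih]; rfl
    simp [mapPolar, evalAt_single, hp]

theorem evalNum_mapPolar (z : ℂ) (g : M →ₗ[ℂ] N) (f : Polar M) :
    evalNum z (mapPolar g f) = g (evalNum z f) :=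
  evalAt_mapPolar g (by simp [Module.algebraMap_end_apply]) f

/-- A singular series is determined by its values at complex numbers. -/
theorem polar_ext {f g : Polar M} (h : ∀ z : ℂ, evalNum z f = evalNum z g) : f = g := by
  suffices H : ∀ f : Polar M, (∀ z : ℂ, evalNum z f = 0) → f = 0 from
    sub_eq_zero.mp (H _ fun z => by rw [map_sub, h, sub_self])
  intro f hf
  ext n
  refine (Module.forall_dual_apply_eq_zero_iff ℂ _).mp fun φ => ?_
  let p : ℂ[X] := f.sum fun k m => Polynomial.monomial k ((1 / (k.factorial : ℂ)) * φ m)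
  have hp : p = 0 := by
    refine Polynomial.funext fun z => ?_
    have := congrArg φ (hf z)
    simp only [evalAt, Finsupp.lsum_apply, Finsupp.sum, map_sum, LinearMap.smul_apply, map_zero,
      map_smul, ← map_pow, Module.algebraMap_end_apply, smul_eq_mul] at this
    simp only [p, Finsupp.sum, Polynomial.eval_finsetSum, Polynomial.eval_monomial,
      Polynomial.eval_zero]
    rw [← this]
    exact Finset.sum_congr rfl fun k _ => by ring
  have hc := congrArg (fun q => Polynomial.coeff q n) hp
  simp only [p, Finsupp.sum, Polynomial.finsetSum_coeff, Polynomial.coeff_monomial,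
    Polynomial.coeff_zero, Finset.sum_ite_eq'] at hc
  by_cases hn : f n = 0
  · simp [hn]
  · rw [if_pos (Finsupp.mem_support_iff.mpr hn)] at hc
    refine (mul_eq_zero.mp hc).resolve_left ?_
    have : (n.factorial : ℂ) ≠ 0 := by exact_mod_cast n.factorial_ne_zero
    simpa using this

theorem commute_algebraMap (z : ℂ) (T : Module.End ℂ M) :
    Commute (algebraMap ℂ (Module.End ℂ M) z) T :=
  Algebra.commutes z T

theorem commute_neg_add {P T : Module.End ℂ M} (h : Commute P T) : Commute (-(P + T)) T :=
  (h.add_left (Commute.refl T)).neg_left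

/-- The twist `f ↦ Sing (e ^ (x T) f(-x))` intertwines `d/dx` and `T - d/dx`. -/
theorem skew_ddx (T : Module.End ℂ M) (f : Polar M) :
    singExp T (negx (ddx f)) = mapPolar T (singExp T (negx f)) - ddx (singExp T (negx f)) := by
  refine polar_ext fun z => ?_
  rw [map_sub, evalNum_mapPolar, evalAt_ddx, evalAt_skew (commute_algebraMap z T),
    evalAt_skew (commute_algebraMap z T), evalAt_ddx]
  simp only [LinearMap.neg_apply, LinearMap.add_apply, Module.algebraMap_end_apply, map_neg]
  module

theorem skew_sub_ddx (T : Module.End ℂ M) (f : Polar M) :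
    singExp T (negx (mapPolar T f - ddx f)) = ddx (singExp T (negx f)) := by
  refine polar_ext fun z => ?_
  have hc : ∀ m, (-(algebraMap ℂ _ z + T)) (T m) = T ((-(algebraMap ℂ _ z + T)) m) := fun m => by
    simp [Module.algebraMap_end_apply]
  rw [evalAt_ddx, evalAt_skew (commute_algebraMap z T), evalAt_skew (commute_algebraMap z T),
    map_sub, evalAt_mapPolar T hc, evalAt_ddx]
  simp only [LinearMap.neg_apply, LinearMap.add_apply, Module.algebraMap_end_apply, map_neg]
  module

/-- The twist is an involution. -/
theorem skew_skew (T : Module.End ℂ M) (f : Polar M) :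
    singExp T (negx (singExp T (negx f))) = f := by
  refine polar_ext fun z => ?_
  have h := commute_algebraMap z T
  rw [evalAt_skew h, evalAt_skew (commute_neg_add h), neg_neg]
  congr 2
  abel

end Evaluation

/-! ### The Jacobi identity and its permutations -/

section Jacobi

variable {M : Type*} [AddCommGroup M] [Module ℂ M]

/-- The bracket `∑ n, z ^ n / n! * a_n b` at a complex number `z`, as an operator on `b`. -/
def bracket (Y : M →ₗ[ℂ] M →ₗ[ℂ] Polar M) (z : ℂ) : M →ₗ[ℂ] M →ₗ[ℂ] M :=
  Y.compr₂ (evalNum z)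

theorem bracket_apply (Y : M →ₗ[ℂ] M →ₗ[ℂ] Polar M) (z : ℂ) (a b : M) :
    bracket Y z a b = evalNum z (Y a b) := rfl

/-- The Jacobi identity of the brackets: this is the half commutator formula after the Laplace
transform in both variables. -/
def Jacobi (Y : M →ₗ[ℂ] M →ₗ[ℂ] Polar M) (a b c : M) : Prop :=
  ∀ z w : ℂ, bracket Y z a (bracket Y w b c) - bracket Y w b (bracket Y z a c) =
    bracket Y (z + w) (bracket Y z a b) c

/-- Exchange of the two variables of a singular series in two variables. -/
def swapVars : Polar (Polar M) →ₗ[ℂ] Polar (Polar M) :=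
  Finsupp.lsum ℂ fun i => Finsupp.lsum ℂ fun k => Finsupp.lsingle k ∘ₗ Finsupp.lsingle i

theorem swapVars_apply (G : Polar (Polar M)) (m n : ℕ) : swapVars G m n = G n m := by
  induction G using Finsupp.induction_linear with
  | zero => simp
  | add f g hf hg => simp only [map_add, Finsupp.add_apply, hf, hg]
  | single i f =>
    induction f using Finsupp.induction_linear with
    | zero => simp
    | add f g hf hg => simp only [map_add, Finsupp.single_add, Finsupp.add_apply, hf, hg]
    | single k x =>
      simp only [swapVars, Finsupp.lsum_single, LinearMap.comp_apply, Finsupp.lsingle_apply]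
      by_cases h1 : k = m <;> by_cases h2 : i = n <;> simp [h1, h2]

theorem evalNum_swapVars (z w : ℂ) (G : Polar (Polar M)) :
    evalNum w (evalNum (algebraMap ℂ ℂ z) (swapVars G)) = evalNum z (evalNum w G) := by
  induction G using Finsupp.induction_linear with
  | zero => simp
  | add f g hf hg => simp only [map_add, hf, hg]
  | single i f =>
    induction f using Finsupp.induction_linear with
    | zero => simp
    | add f g hf hg => simp only [map_add, Finsupp.single_add, hf, hg]
    | single k x =>
      simp only [swapVars, Finsupp.lsum_single, LinearMap.comp_apply, Finsupp.lsingle_apply,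
        evalAt_single, ← map_pow, Module.algebraMap_end_apply, map_smul, Algebra.algebraMap_self,
        RingHom.id_apply]
      module

/-- The substitution of `x₁ - x₂` for the first variable, expanded in nonnegative powers of `x₂`,
followed by `Sing`: it sends `x₁ ^ (-i-1) x₂ ^ (-k-1)` to
`∑ j ≤ k, (i + j choose i) x₁ ^ (-i-j-1) x₂ ^ (-k+j-1)`. -/
def subVars : Polar (Polar M) →ₗ[ℂ] Polar (Polar M) :=
  Finsupp.lsum ℂ fun i => Finsupp.lsum ℂ fun k => ∑ j ∈ Finset.range (k + 1),
    ((i + j).choose i : ℂ) • (Finsupp.lsingle (i + j) ∘ₗ Finsupp.lsingle (k - j))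

theorem subVars_single (i k : ℕ) (x : M) :
    subVars (Finsupp.single i (Finsupp.single k x)) = ∑ j ∈ Finset.range (k + 1),
      ((i + j).choose i : ℂ) • Finsupp.single (i + j) (Finsupp.single (k - j) x) := by
  simp only [subVars, Finsupp.lsum_single, LinearMap.sum_apply, LinearMap.smul_apply,
    LinearMap.comp_apply, Finsupp.lsingle_apply]

theorem subVars_apply (G : Polar (Polar M)) (m n : ℕ) :
    subVars G m n = ∑ i ∈ Finset.range (m + 1), (m.choose i : ℂ) • G i (m + n - i) := by
  induction G using Finsupp.induction_linear with
  | zero => simp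
  | add f g hf hg =>
    simp only [map_add, Finsupp.add_apply, hf, hg, smul_add, Finset.sum_add_distrib]
  | single i f =>
    induction f using Finsupp.induction_linear with
    | zero => simp
    | add f g hf hg =>
      simp only [map_add, Finsupp.single_add, Finsupp.add_apply, hf, hg, smul_add,
        Finset.sum_add_distrib]
    | single k x =>
      rw [subVars_single]
      simp only [Finsupp.finsetSum_apply, Finsupp.smul_apply]
      by_cases h : i ≤ m ∧ k = m + n - i
      · obtain ⟨him, rfl⟩ := h
        rw [Finset.sum_eq_single (m - i), Finset.sum_eq_single i]
        · have h1 : i + (m - i) = m := by omega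
          have h2 : m + n - i - (m - i) = n := by omega
          simp [h1, h2]
        · intro j _ hj
          simp [hj.symm]
        · intro h; exact absurd (Finset.mem_range.mpr (by omega)) h
        · intro j _ hj
          have : i + j ≠ m := by omega
          simp [this]
        · intro h; exact absurd (Finset.mem_range.mpr (by omega)) h
      · rw [Finset.sum_eq_zero, Finset.sum_eq_zero]
        · intro j hj
          rw [Finset.mem_range] at hj
          by_cases hij : i = j
          · subst hij
            have : k ≠ m + n - i := fun hk => h ⟨by omega, hk⟩
            simp [this]
          · simp [hij]
        · intro j hj
          rw [Finset.mem_range] at hj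
          by_cases hij : i + j = m
          · have : k - j ≠ n := fun hk => h ⟨by omega, by omega⟩
            simp [hij, this]
          · simp [hij]

theorem evalNum_subVars (z w : ℂ) (G : Polar (Polar M)) :
    evalNum w (evalNum z (subVars G)) = evalNum (z + w) (evalNum z G) := by
  induction G using Finsupp.induction_linear with
  | zero => simp
  | add f g hf hg => simp only [map_add, hf, hg]
  | single i f =>
    induction f using Finsupp.induction_linear with
    | zero => simp
    | add f g hf hg => simp only [map_add, Finsupp.single_add, hf, hg]
    | single k x =>
      rw [subVars_single]
      simp only [map_sum, map_smul, evalAt_single, ← map_pow, Module.algebraMap_end_apply,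
        smul_smul]
      rw [← Finset.sum_smul, add_pow, Finset.mul_sum, Finset.mul_sum]
      congr 1
      refine Finset.sum_congr rfl fun j hj => ?_
      have hj' : j ≤ k := by simpa [Nat.lt_succ_iff] using hj
      rw [Nat.cast_choose ℂ hj', Nat.cast_choose ℂ (Nat.le_add_right i j), Nat.add_sub_cancel_left]
      have h1 : (i.factorial : ℂ) ≠ 0 := by exact_mod_cast i.factorial_ne_zero
      have h2 : (j.factorial : ℂ) ≠ 0 := by exact_mod_cast j.factorial_ne_zero
      have h3 : (k.factorial : ℂ) ≠ 0 := by exact_mod_cast k.factorial_ne_zero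
      have h4 : ((i + j).factorial : ℂ) ≠ 0 := by exact_mod_cast (i + j).factorial_ne_zero
      have h5 : ((k - j).factorial : ℂ) ≠ 0 := by exact_mod_cast (k - j).factorial_ne_zero
      field_simp
      ring

/-- The half commutator formula, as an equality of coefficients, is the Jacobi identity of the
brackets. -/
theorem jacobi_iff (Y : M →ₗ[ℂ] M →ₗ[ℂ] Polar M) (a b c : M) :
    Jacobi Y a b c ↔ ∀ m n, Y a (Y b c n) m - Y b (Y a c m) n =
      ∑ i ∈ Finset.range (m + 1), (m.choose i : ℂ) • Y (Y a b i) c (m + n - i) := by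
  let F : Polar (Polar M) := swapVars (mapPolar (Y a) (Y b c)) - mapPolar (Y b) (Y a c)
  let G : Polar (Polar M) := subVars (mapPolar (Y.flip c) (Y a b))
  have hF : ∀ m n, F m n = Y a (Y b c n) m - Y b (Y a c m) n := fun m n => by
    simp [F, swapVars_apply, mapPolar]
  have hG : ∀ m n, G m n = ∑ i ∈ Finset.range (m + 1),
      (m.choose i : ℂ) • Y (Y a b i) c (m + n - i) := fun m n => by
    simp [G, subVars_apply, mapPolar]
  have hF' : ∀ z w, evalNum w (evalNum z F) =
      bracket Y z a (bracket Y w b c) - bracket Y w b (bracket Y z a c) := fun z w => by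
    simp only [F, map_sub]
    rw [← Algebra.algebraMap_self_apply z, evalNum_swapVars, evalNum_mapPolar, evalNum_mapPolar]
    rfl
  have hG' : ∀ z w, evalNum w (evalNum z G) = bracket Y (z + w) (bracket Y z a b) c :=
    fun z w => by
      simp only [G]
      rw [evalNum_subVars, evalNum_mapPolar]
      rfl
  calc Jacobi Y a b c ↔ F = G :=
        ⟨fun h => polar_ext fun z => polar_ext fun w => by rw [hF', hG', h],
          fun h z w => by rw [← hF', ← hG', h]⟩
    _ ↔ _ := ⟨fun h m n => by rw [← hF, ← hG, h],
          fun h => Finsupp.ext fun m => Finsupp.ext fun n => by rw [hF, hG, h]⟩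

variable {T : Module.End ℂ M} {Y : M →ₗ[ℂ] M →ₗ[ℂ] Polar M}

theorem bracket_skew (hs : ∀ a b, Y a b = singExp T (negx (Y b a))) (z : ℂ) (a b : M) :
    bracket Y z a b = -evalAt (-(algebraMap ℂ _ z + T)) (Y b a) := by
  rw [bracket_apply, hs a b, evalAt_skew (commute_algebraMap z T)]

theorem bracket_derivative_left (hT : ∀ a b, Y (T a) b = ddx (Y a b)) (z : ℂ) (a b : M) :
    bracket Y z (T a) b = -z • bracket Y z a b := by
  rw [bracket_apply, hT, evalAt_ddx, Module.algebraMap_end_apply, neg_smul]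
  rfl

theorem bracket_derivative_right (hT : ∀ a b, Y (T a) b = ddx (Y a b))
    (hs : ∀ a b, Y a b = singExp T (negx (Y b a))) (z : ℂ) (a b : M) :
    bracket Y z a (T b) = z • bracket Y z a b + T (bracket Y z a b) := by
  rw [bracket_skew hs, bracket_skew hs, hT, evalAt_ddx]
  simp only [LinearMap.neg_apply, LinearMap.add_apply, Module.algebraMap_end_apply, map_neg]
  module

theorem Jacobi.swap_left (hT : ∀ a b, Y (T a) b = ddx (Y a b))
    (hs : ∀ a b, Y a b = singExp T (negx (Y b a))) {a b c : M} (h : Jacobi Y a b c) :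
    Jacobi Y b a c := by
  intro z w
  have key : bracket Y (z + w) (bracket Y z b a) c = -bracket Y (w + z) (bracket Y w a b) c := by
    rw [bracket_skew hs z b a, map_neg, LinearMap.neg_apply, add_comm w z]
    congr 1
    have h1 := evalAt_mapPolar (P := -(algebraMap ℂ _ z + T)) (Q := algebraMap ℂ _ w)
      ((bracket Y (z + w)).flip c) (fun m => by
        simp only [LinearMap.flip_apply, LinearMap.neg_apply, LinearMap.add_apply,
          Module.algebraMap_end_apply, map_neg, map_add, map_smul,
          bracket_derivative_left hT]
        module) (Y a b)
    rw [← LinearMap.flip_apply, ← h1, evalNum_mapPolar]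
    rfl
  rw [key, ← h w z, neg_sub]

theorem Jacobi.swap_right (hT : ∀ a b, Y (T a) b = ddx (Y a b))
    (hs : ∀ a b, Y a b = singExp T (negx (Y b a))) {a b c : M} (h : Jacobi Y a b c) :
    Jacobi Y a c b := by
  intro z w
  -- For fixed `z` the identity is polynomial in `w`, so the operator `-z-w-T` may be substituted.
  have h1 : mapPolar (bracket Y z a) (Y b c) - Y b (bracket Y z a c) =
      singExp (algebraMap ℂ _ z) (Y (bracket Y z a b) c) := polar_ext fun v => by
    rw [map_sub, evalNum_mapPolar, evalAt_singExp (commute_algebraMap _ _), ← map_add, add_comm v z]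
    exact h z v
  have h2 := congrArg (evalAt (-(algebraMap ℂ _ (z + w) + T))) h1
  have h3 : evalAt (-(algebraMap ℂ _ (z + w) + T)) (mapPolar (bracket Y z a) (Y b c)) =
      bracket Y z a (evalAt (-(algebraMap ℂ _ w + T)) (Y b c)) :=
    evalAt_mapPolar _ (fun m => by
      simp only [LinearMap.neg_apply, LinearMap.add_apply, Module.algebraMap_end_apply, map_neg,
        map_add, map_smul, bracket_derivative_right hT hs]
      module) _
  have hc : Commute (-(algebraMap ℂ (Module.End ℂ M) (z + w) + T)) (algebraMap ℂ _ z) :=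
    (Algebra.commutes z _).symm
  rw [map_sub, h3, evalAt_singExp hc] at h2
  have h4 : -(algebraMap ℂ (Module.End ℂ M) (z + w) + T) + algebraMap ℂ _ z =
      -(algebraMap ℂ _ w + T) := by
    rw [map_add]; abel
  rw [h4] at h2
  rw [bracket_skew hs w c b, bracket_skew hs w c, bracket_skew hs (z + w), map_neg, ← sub_eq_zero]
  rw [← sub_eq_zero] at h2
  rw [← neg_eq_zero, ← h2]
  abel

/-- By skew symmetry the Jacobi identity is invariant under permutations of its arguments. Hence it
holds everywhere if it holds on a set `G` and if, for all `a` and `b`, its validity for all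
`c ∈ G` implies its validity for all `c`. -/
theorem isVertexLieAlgebra_of_generators (hT : ∀ a b, Y (T a) b = ddx (Y a b))
    (hs : ∀ a b, Y a b = singExp T (negx (Y b a))) (G : Set M)
    (hG : ∀ a ∈ G, ∀ b ∈ G, ∀ c ∈ G, Jacobi Y a b c)
    (hgen : ∀ a b, (∀ c ∈ G, Jacobi Y a b c) → ∀ c, Jacobi Y a b c) :
    IsVertexLieAlgebra T Y where
  derivative := hT
  half_skew := hs
  half_commutator a b c := by
    refine (jacobi_iff Y a b c).mp ?_
    have h1 : ∀ u ∈ G, ∀ v ∈ G, ∀ c, Jacobi Y u v c := fun u hu v hv =>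
      hgen u v (hG u hu v hv)
    have h2 : ∀ u ∈ G, ∀ c d, Jacobi Y u c d := fun u hu c =>
      hgen u c fun v hv => (h1 u hu v hv c).swap_right hT hs
    exact hgen a b (fun u hu => ((h2 u hu a b).swap_left hT hs).swap_right hT hs) c

end Jacobi

/-! ### Linear maps on `ℂ[𝒟] ⊗ W` -/

section FreeModule

variable {W N : Type*} [AddCommGroup W] [Module ℂ W] [AddCommGroup N] [Module ℂ N]

theorem linearMap_ext_monomials {f g : ℂ[X] ⊗[ℂ] W →ₗ[ℂ] N}
    (h : ∀ (n : ℕ) (w : W),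
      f ((Polynomial.X ^ n : ℂ[X]) ⊗ₜ w) = g ((Polynomial.X ^ n : ℂ[X]) ⊗ₜ w)) :
    f = g := by
  refine TensorProduct.ext (Polynomial.lhom_ext' fun n => LinearMap.ext_ring ?_)
  ext w
  simpa [Polynomial.X_pow_eq_monomial] using h n w

theorem opD_tmul (n : ℕ) (w : W) :
    opD W ((Polynomial.X ^ n : ℂ[X]) ⊗ₜ w) = (Polynomial.X ^ (n + 1) : ℂ[X]) ⊗ₜ w := by
  simp [opD, pow_succ']

theorem opD_one_tmul (w : W) :
    opD W ((1 : ℂ[X]) ⊗ₜ w) = (Polynomial.X : ℂ[X]) ⊗ₜ w := by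
  simp [opD]

end FreeModule

namespace OneTruncatedConformalAlgebra

variable {A B : Type*} [AddCommGroup A] [Module ℂ A] [AddCommGroup B] [Module ℂ B]
  (V : OneTruncatedConformalAlgebra A B)

/-! ### Products in a 1-truncated conformal algebra -/

theorem mem_gr_zero (a : A) : ((a, 0) : A × B) ∈ gr A B 0 := ⟨a, rfl⟩

theorem mem_gr_one (b : B) : ((0, b) : A × B) ∈ gr A B 1 := ⟨b, rfl⟩

theorem eq_zero_of_mem_gr {n : ℤ} (hn : n < 0) {x : A × B} (h : x ∈ gr A B n) : x = 0 := by
  rw [gr, if_neg (by omega), if_neg (by omega)] at h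
  exact h

theorem mul_inl_inl (i : Fin 2) (a a' : A) : V.mul i (a, 0) (a', 0) = 0 :=
  eq_zero_of_mem_gr (by omega) (V.degree i 0 0 _ (mem_gr_zero a) _ (mem_gr_zero a'))

theorem mul_one_inl_inr (a : A) (b : B) : V.mul 1 (a, 0) (0, b) = 0 :=
  eq_zero_of_mem_gr (by simp) (V.degree 1 0 1 _ (mem_gr_zero a) _ (mem_gr_one b))

theorem mul_one_inr_inl (a : A) (b : B) : V.mul 1 (0, b) (a, 0) = 0 :=
  eq_zero_of_mem_gr (by simp) (V.degree 1 1 0 _ (mem_gr_one b) _ (mem_gr_zero a))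

theorem prod_eq_add {A B : Type*} [AddCommGroup A] [AddCommGroup B] (u : A × B) :
    u = (u.1, 0) + (0, u.2) := by
  simp

theorem mul_one_inl (a : A) (u : A × B) : V.mul 1 (a, 0) u = 0 := by
  rw [prod_eq_add u, map_add, mul_inl_inl, mul_one_inl_inr, add_zero]

theorem mul_one_to_inl (u : A × B) (a : A) : V.mul 1 u (a, 0) = 0 := by
  rw [prod_eq_add u, map_add, LinearMap.add_apply, mul_inl_inl, mul_one_inr_inl, add_zero]

theorem mul_one_eq (u v : A × B) : V.mul 1 u v = V.mul 1 (0, u.2) (0, v.2) := by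
  conv_lhs => rw [prod_eq_add u, prod_eq_add v]
  simp only [map_add, LinearMap.add_apply, mul_one_inl, mul_one_to_inl, zero_add]

theorem mul_one_snd (u v : A × B) : (V.mul 1 u v).2 = 0 := by
  rw [mul_one_eq]
  obtain ⟨a, ha⟩ : V.mul 1 (0, u.2) (0, v.2) ∈ gr A B 0 := by
    simpa using V.degree 1 1 1 _ (mem_gr_one u.2) _ (mem_gr_one v.2)
  rw [← ha]
  rfl

theorem mul_one_comm (u v : A × B) : V.mul 1 u v = V.mul 1 v u := by
  rw [mul_one_eq, V.symm_one, ← mul_one_eq]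

theorem mul_one_eq_inl (u v : A × B) : V.mul 1 u v = ((V.mul 1 u v).1, 0) :=
  Prod.ext rfl (V.mul_one_snd u v)

theorem mul_zero_skew (u v : A × B) :
    V.mul 0 u v = -V.mul 0 v u + (0, V.d (V.mul 1 v u).1) := by
  rw [mul_one_eq]
  conv_lhs => rw [prod_eq_add u, prod_eq_add v]
  conv_rhs => enter [1]; rw [prod_eq_add u, prod_eq_add v]
  simp only [map_add, LinearMap.add_apply, mul_inl_inl, V.comm_zero, V.skew_zero u.2 v.2]
  abel

theorem mul_one_one_left (u v w : A × B) : V.mul 1 (V.mul 1 u v) w = 0 := by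
  rw [V.mul_one_eq_inl u v, mul_one_inl]

theorem mul_one_one_right (u v w : A × B) : V.mul 1 u (V.mul 1 v w) = 0 := by
  rw [V.mul_one_eq_inl v w, mul_one_to_inl]

/-- The case `i = 1`, `j = 0` of the commutator formula for `u_i` and `v_j`. It is not among the
axioms, and follows from the case `i = 0`, `j = 1` by skew symmetry and `(∂ a)_1 = -a_0`. -/
theorem mul_one_mul_zero (u v w : A × B) :
    V.mul 1 u (V.mul 0 v w) - V.mul 0 v (V.mul 1 u w) =
      V.mul 1 (V.mul 0 u v) w + V.mul 0 (V.mul 1 u v) w := by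
  have h1 := V.assoc 1 v u w
  have h2 : V.mul 1 (V.mul 0 u v) w = -V.mul 1 (V.mul 0 v u) w - V.mul 0 (V.mul 1 u v) w := by
    rw [V.mul_zero_skew u v, map_add, LinearMap.add_apply, V.d_mul_one, ← V.mul_one_eq_inl,
      V.mul_one_comm v u, map_neg, LinearMap.neg_apply, LinearMap.neg_apply, sub_eq_add_neg]
  rw [h1, h2]
  abel

/-! ### The vertex Lie algebra `𝒞` -/

theorem evalAt_baseY (P : Module.End ℂ V.FreeC) (u v : A × B) :
    evalAt P (V.baseY u v) =
      (1 : ℂ[X]) ⊗ₜ V.mul 0 u v + P ((1 : ℂ[X]) ⊗ₜ V.mul 1 u v) := by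
  simp [baseY, monom, evalAt_single]

theorem evalAt_genY {P : Module.End ℂ V.FreeC} (hP : Commute P (opD (A × B))) (u v : A × B)
    (n : ℕ) : evalAt P (V.genY u ((Polynomial.X ^ n : ℂ[X]) ⊗ₜ v)) =
      ((opD (A × B) + P) ^ n) (evalAt P (V.baseY u v)) := by
  rw [genY_apply, map_sum, hP.symm.add_pow, LinearMap.sum_apply]
  refine Finset.sum_congr rfl fun i _ => ?_
  have hc : ∀ m, P ((opD (A × B) ^ i) m) = (opD (A × B) ^ i) (P m) := fun m =>
    LinearMap.congr_fun (hP.pow_right i).eq m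
  rw [map_smul, evalAt_mapPolar _ hc, evalAt_ddx_pow, ← nsmul_eq_mul',
    ← Nat.cast_smul_eq_nsmul ℂ]
  rw [neg_pow_eq_smul]
  simp only [Module.End.mul_apply, map_smul, LinearMap.smul_apply, smul_smul]
  congr 1
  rw [mul_assoc, ← mul_pow]
  simp

theorem evalNum_skewY (z : ℂ) (u v : A × B) (n m : ℕ) :
    evalNum z (V.skewY n u ((Polynomial.X ^ m : ℂ[X]) ⊗ₜ v)) =
      (-z) ^ n • ((algebraMap ℂ _ z + opD (A × B)) ^ m)
        (-evalAt (-(algebraMap ℂ _ z + opD (A × B))) (V.baseY v u)) := by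
  have hc := commute_algebraMap z (opD (A × B))
  have hs : opD (A × B) + -(algebraMap ℂ _ z + opD (A × B)) =
      algebraMap ℂ (Module.End ℂ V.FreeC) (-z) := by
    rw [map_neg]
    abel
  rw [skewY_apply, evalAt_singExp hc, evalAt_neg_ddx_pow, evalAt_negx,
    evalAt_genY V (commute_neg_add hc), hs, ← map_pow, Module.algebraMap_end_apply, ← smul_neg,
    map_smul]

theorem proj_tmul (n : ℕ) (a : A) :
    V.proj ((Polynomial.X ^ (n + 1) : ℂ[X]) ⊗ₜ (a, 0)) =
      V.proj ((Polynomial.X ^ n : ℂ[X]) ⊗ₜ (0, V.d a)) := by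
  rw [eq_comm, Submodule.mkQ_apply, Submodule.mkQ_apply, Submodule.Quotient.eq]
  exact ⟨(Polynomial.X ^ n : ℂ[X]) ⊗ₜ a, by simp [dHat, opD, pow_succ']⟩

theorem quotD_proj (f : V.FreeC) : V.quotD (V.proj f) = V.proj (opD (A × B) f) := rfl

/-- The map `u ↦ 1 ⊗ u` from `A ⊕ B` to the quotient `𝒞`. -/
def gen : A × B →ₗ[ℂ] V.QuotC := V.proj ∘ₗ monom 0

theorem proj_one_tmul (u : A × B) : V.proj ((1 : ℂ[X]) ⊗ₜ u) = V.gen u := by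
  simp [gen, monom]

theorem quotD_gen_inl (a : A) : V.quotD (V.gen (a, 0)) = V.gen (0, V.d a) := by
  rw [← proj_one_tmul, ← proj_one_tmul, quotD_proj, opD_one_tmul]
  simpa using V.proj_tmul 0 a

/-- The value at `λ = z` of the series `Y⁰₋(u, x) v`, in the quotient `𝒞`. -/
def genBracket (z : ℂ) : (A × B) →ₗ[ℂ] (A × B) →ₗ[ℂ] V.QuotC :=
  (V.mul 0).compr₂ V.gen + z • (V.mul 1).compr₂ V.gen

theorem genBracket_apply (z : ℂ) (u v : A × B) :
    V.genBracket z u v = V.gen (V.mul 0 u v) + z • V.gen (V.mul 1 u v) := rfl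

/-- Skew symmetry on generators: it holds in the quotient `𝒞` only, as it uses that `𝒟 a` and
`∂ a` are identified there. -/
theorem genBracket_skew (z : ℂ) (u v : A × B) :
    V.proj (-evalAt (-(algebraMap ℂ _ z + opD (A × B))) (V.baseY v u)) = V.genBracket z u v := by
  rw [evalAt_baseY, genBracket_apply, V.mul_zero_skew u v, V.mul_one_comm v u]
  simp only [map_neg, map_add, LinearMap.neg_apply, LinearMap.add_apply,
    Module.algebraMap_end_apply, map_smul, ← quotD_proj, proj_one_tmul]
  rw [V.mul_one_eq_inl u v, quotD_gen_inl]
  abel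

theorem proj_pow (z : ℂ) (m : ℕ) (f : V.FreeC) :
    V.proj (((algebraMap ℂ _ z + opD (A × B)) ^ m) f) =
      ((algebraMap ℂ _ z + V.quotD) ^ m) (V.proj f) := by
  induction m with
  | zero => rfl
  | succ m ih =>
    rw [pow_succ', pow_succ', Module.End.mul_apply, Module.End.mul_apply, ← ih]
    simp only [LinearMap.add_apply, Module.algebraMap_end_apply, map_add, map_smul, quotD_proj]

/-- The series `Y⁰₋(f, x) g` in the quotient `𝒞`. -/
def projY : V.FreeC →ₗ[ℂ] V.FreeC →ₗ[ℂ] Polar V.QuotC := V.freeY.compr₂ (mapPolar V.proj)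

/-- Sesquilinearity of the Laplace transform of `Y⁰₋`. It is stated modulo `∂̂ C(A)`, because for
`n ≥ 1` the series `Y⁰₋(𝒟ⁿ ⊗ u, x)` is defined by skew symmetry. -/
theorem evalNum_projY (z : ℂ) (u v : A × B) (n m : ℕ) :
    evalNum z (V.projY ((Polynomial.X ^ n : ℂ[X]) ⊗ₜ u) ((Polynomial.X ^ m : ℂ[X]) ⊗ₜ v)) =
      (-z) ^ n • ((algebraMap ℂ _ z + V.quotD) ^ m) (V.genBracket z u v) := by
  rw [projY, LinearMap.compr₂_apply, evalNum_mapPolar]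
  rcases Nat.eq_zero_or_pos n with rfl | hn
  · rw [pow_zero, pow_zero, one_smul, freeY_zero, evalAt_genY V (commute_algebraMap _ _),
      add_comm (opD (A × B)), proj_pow, evalAt_baseY]
    simp only [map_add, Module.algebraMap_end_apply, map_smul, proj_one_tmul, genBracket_apply]
  · rw [freeY_pos V n hn, evalNum_skewY, map_smul, proj_pow, genBracket_skew]

theorem projY_opD (f g : V.FreeC) : V.projY (opD (A × B) f) g = ddx (V.projY f g) := by
  suffices V.projY ∘ₗ opD (A × B) = V.projY.compr₂ ddx from LinearMap.congr_fun₂ this f g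
  refine linearMap_ext_monomials fun n u => linearMap_ext_monomials fun m v =>
    polar_ext fun z => ?_
  rw [LinearMap.comp_apply, opD_tmul, evalNum_projY, LinearMap.compr₂_apply, evalAt_ddx,
    evalNum_projY, Module.algebraMap_end_apply, pow_succ]
  module

theorem projY_opD_right (f g : V.FreeC) :
    V.projY f (opD (A × B) g) = mapPolar V.quotD (V.projY f g) - ddx (V.projY f g) := by
  suffices V.projY.compl₂ (opD (A × B)) = V.projY.compr₂ (mapPolar V.quotD - ddx) from
    LinearMap.congr_fun₂ this f g
  refine linearMap_ext_monomials fun n u => linearMap_ext_monomials fun m v =>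
    polar_ext fun z => ?_
  rw [LinearMap.compl₂_apply, opD_tmul, evalNum_projY, LinearMap.compr₂_apply, LinearMap.sub_apply,
    map_sub, evalAt_ddx, evalNum_mapPolar, evalNum_projY, Module.algebraMap_end_apply, map_smul,
    pow_succ']
  simp only [Module.End.mul_apply, LinearMap.add_apply, Module.algebraMap_end_apply]
  module

theorem projY_skew (f g : V.FreeC) : V.projY f g = singExp V.quotD (negx (V.projY g f)) := by
  suffices V.projY = (V.projY.flip).compr₂ (singExp V.quotD ∘ₗ negx) from
    LinearMap.congr_fun₂ this f g
  refine linearMap_ext_monomials fun n u => linearMap_ext_monomials fun m v => ?_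
  simp only [LinearMap.compr₂_apply, LinearMap.flip_apply, LinearMap.comp_apply]
  induction n with
  | succ n ih => rw [← opD_tmul, projY_opD, projY_opD_right, skew_sub_ddx, ih]
  | zero =>
    induction m with
    | succ m ih => rw [← opD_tmul, projY_opD, projY_opD_right, skew_ddx, ih]
    | zero =>
      have h : V.projY ((Polynomial.X ^ 0 : ℂ[X]) ⊗ₜ v) ((Polynomial.X ^ 0 : ℂ[X]) ⊗ₜ u) =
          mapPolar V.proj (V.baseY v u) := by
        refine polar_ext fun z => ?_
        rw [evalNum_projY, evalNum_mapPolar, evalAt_baseY]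
        simp [proj_one_tmul, genBracket_apply, Module.algebraMap_end_apply, -Submodule.mkQ_apply]
      refine polar_ext fun z => ?_
      rw [h, evalNum_projY, evalAt_skew (commute_algebraMap z _), evalAt_mapPolar
        (P := -(algebraMap ℂ _ z + opD (A × B))) V.proj (fun f => ?_), ← map_neg, genBracket_skew]
      · simp
      · simp only [LinearMap.neg_apply, LinearMap.add_apply, Module.algebraMap_end_apply, map_neg,
          map_add, map_smul, quotD_proj]

theorem projY_dHat (c : ℂ[X] ⊗[ℂ] A) : V.projY (V.dHat c) = 0 := by
  suffices V.projY ∘ₗ V.dHat = 0 from LinearMap.congr_fun this c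
  refine linearMap_ext_monomials fun n a => linearMap_ext_monomials fun m v =>
    polar_ext fun z => ?_
  have h : V.dHat ((Polynomial.X ^ n : ℂ[X]) ⊗ₜ a) = (Polynomial.X ^ n : ℂ[X]) ⊗ₜ (0, V.d a) -
      (Polynomial.X ^ (n + 1) : ℂ[X]) ⊗ₜ (a, 0) := by
    simp [dHat, opD, pow_succ']
  have h' : V.genBracket z (0, V.d a) v = -z • V.genBracket z (a, 0) v := by
    rw [genBracket_apply, genBracket_apply, V.d_mul_zero, V.d_mul_one, V.mul_one_inl]
    simp
  rw [LinearMap.comp_apply, h, map_sub, LinearMap.sub_apply, map_sub, evalNum_projY, evalNum_projY,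
    h', map_smul, smul_smul, pow_succ, sub_self]
  simp

theorem projY_dHat_right (f : V.FreeC) (c : ℂ[X] ⊗[ℂ] A) : V.projY f (V.dHat c) = 0 := by
  rw [projY_skew, projY_dHat]
  simp

/-- The vertex Lie algebra operation on `𝒞`. -/
def quotY : V.QuotC →ₗ[ℂ] V.QuotC →ₗ[ℂ] Polar V.QuotC :=
  Submodule.liftQ _ (Submodule.liftQ _ V.projY (by
      rintro _ ⟨c, rfl⟩
      exact V.projY_dHat c)).flip (by
    rintro _ ⟨c, rfl⟩
    refine LinearMap.ext fun q => ?_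
    obtain ⟨f, rfl⟩ := Submodule.mkQ_surjective _ q
    exact V.projY_dHat_right f c) |>.flip

theorem quotY_proj (f g : V.FreeC) : V.quotY (V.proj f) (V.proj g) = V.projY f g := rfl

theorem bracket_quotY_gen (z : ℂ) (u v : A × B) :
    bracket V.quotY z (V.gen u) (V.gen v) = V.genBracket z u v := by
  rw [bracket_apply, ← proj_one_tmul, ← proj_one_tmul, quotY_proj]
  simpa using V.evalNum_projY z u v 0 0

theorem jacobi_gen (u v w : A × B) : Jacobi V.quotY (V.gen u) (V.gen v) (V.gen w) := by
  intro z y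
  simp only [bracket_quotY_gen, genBracket_apply, map_add, map_smul, LinearMap.add_apply,
    LinearMap.smul_apply, mul_one_one_left, mul_one_one_right, map_zero, smul_zero, add_zero]
  have h1 := congrArg V.gen (V.assoc 0 u v w)
  have h2 := congrArg V.gen (V.assoc 1 u v w)
  have h3 := congrArg V.gen (V.mul_one_mul_zero u v w)
  simp only [map_add, map_sub] at h1 h2 h3
  rw [h1, h2, sub_eq_iff_eq_add.mp h3]
  module

/-- `𝒞` is generated by `A ⊕ B` as a module over `ℂ[𝒟]`. -/
theorem quotC_induction {p : V.QuotC → Prop} (hgen : ∀ u, p (V.gen u))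
    (hadd : ∀ x y, p x → p y → p (x + y)) (hsmul : ∀ (r : ℂ) x, p x → p (r • x))
    (hD : ∀ x, p x → p (V.quotD x)) (x : V.QuotC) : p x := by
  obtain ⟨f, rfl⟩ := Submodule.mkQ_surjective _ x
  induction f using TensorProduct.induction_on with
  | zero => simpa using hsmul 0 _ (hgen 0)
  | add f g hf hg => rw [map_add]; exact hadd _ _ hf hg
  | tmul q u =>
    induction q using Polynomial.induction_on' with
    | add q r hq hr => rw [TensorProduct.add_tmul, map_add]; exact hadd _ _ hq hr
    | monomial n r =>
      rw [← mul_one r, ← smul_eq_mul, ← Polynomial.smul_monomial, ← TensorProduct.smul_tmul',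
        map_smul, ← Polynomial.X_pow_eq_monomial]
      refine hsmul _ _ ?_
      induction n with
      | zero => rw [pow_zero, proj_one_tmul]; exact hgen u
      | succ n ih => rw [← opD_tmul, ← quotD_proj]; exact hD _ ih

theorem quotY_derivative (a b : V.QuotC) : V.quotY (V.quotD a) b = ddx (V.quotY a b) := by
  obtain ⟨f, rfl⟩ := Submodule.mkQ_surjective _ a
  obtain ⟨g, rfl⟩ := Submodule.mkQ_surjective _ b
  exact V.projY_opD f g

theorem quotY_skew (a b : V.QuotC) : V.quotY a b = singExp V.quotD (negx (V.quotY b a)) := by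
  obtain ⟨f, rfl⟩ := Submodule.mkQ_surjective _ a
  obtain ⟨g, rfl⟩ := Submodule.mkQ_surjective _ b
  exact V.projY_skew f g

theorem isVertexLieAlgebra_quotY : IsVertexLieAlgebra V.quotD V.quotY := by
  refine isVertexLieAlgebra_of_generators V.quotY_derivative V.quotY_skew (Set.range V.gen) ?_ ?_
  · rintro _ ⟨u, rfl⟩ _ ⟨v, rfl⟩ _ ⟨w, rfl⟩
    exact V.jacobi_gen u v w
  · intro a b h c
    induction c using V.quotC_induction with
    | hgen u => exact h _ ⟨u, rfl⟩
    | hadd x y hx hy =>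
      intro z w
      simp only [map_add, ← hx z w, ← hy z w]
      abel
    | hsmul r x hx =>
      intro z w
      simp only [map_smul, ← hx z w, smul_sub]
    | hD x hx =>
      intro z w
      simp only [bracket_derivative_right V.quotY_derivative V.quotY_skew, map_add, map_smul,
        ← hx z w, map_sub]
      module

end OneTruncatedConformalAlgebra

/-! ### The vertex Poisson algebra structure on a symmetric algebra -/

section DifferentialAlgebra

variable {S : Type*} [CommRing S] [Algebra ℂ S]

theorem smul_eq_mapPolar (b : S) (f : Polar S) : b • f = mapPolar (LinearMap.mulLeft ℂ b) f :=
  Finsupp.ext fun n => by simp [mapPolar]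

theorem evalNum_smul (z : ℂ) (b : S) (f : Polar S) : evalNum z (b • f) = b * evalNum z f := by
  rw [smul_eq_mapPolar, evalNum_mapPolar]
  rfl

theorem ddx_smul (b : S) (f : Polar S) : ddx (b • f) = b • ddx f := by
  refine polar_ext fun z => ?_
  rw [evalAt_ddx, evalNum_smul, evalNum_smul, evalAt_ddx]
  simp only [Module.algebraMap_end_apply]
  rw [mul_neg, mul_smul_comm]

theorem mapPolar_derivation_smul (T : Derivation ℂ S S) (b : S) (f : Polar S) :
    mapPolar (T : S →ₗ[ℂ] S) (b • f) = b • mapPolar (T : S →ₗ[ℂ] S) f + T b • f := by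
  ext n
  simp [mapPolar, mul_comm]

/-- The conjugate of multiplication by `b` under the twist; explicitly it is the operation
`f ↦ Sing ((e ^ (x T) b) f)`. -/
def twistedMul (T : Derivation ℂ S S) (b : S) (f : Polar S) : Polar S :=
  singExp (T : S →ₗ[ℂ] S) (negx (b • singExp (T : S →ₗ[ℂ] S) (negx f)))

variable (T : Derivation ℂ S S)

theorem twistedMul_add (b : S) (f g : Polar S) :
    twistedMul T b (f + g) = twistedMul T b f + twistedMul T b g := by
  simp only [twistedMul, map_add, smul_add]

theorem twistedMul_ddx (b : S) (f : Polar S) :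
    twistedMul T b (ddx f) = ddx (twistedMul T b f) - twistedMul T (T b) f := by
  have h : ∀ h : Polar S, b • (mapPolar (T : S →ₗ[ℂ] S) h - ddx h) =
      (mapPolar (T : S →ₗ[ℂ] S) (b • h) - ddx (b • h)) - T b • h := fun h => by
    rw [mapPolar_derivation_smul, ddx_smul, smul_sub]
    abel
  rw [twistedMul, skew_ddx, h, map_sub, map_sub, skew_sub_ddx]
  rfl

/-- Twisted and ordinary multiplications commute. The series are generated by those of the form
`m * x ^ (-1)` under `d/dx`. -/
theorem twistedMul_smul (b c : S) (f : Polar S) :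
    twistedMul T b (c • f) = c • twistedMul T b f := by
  induction f using Finsupp.induction_linear with
  | zero => simp [twistedMul]
  | add f g hf hg => rw [smul_add, twistedMul_add, hf, hg, twistedMul_add, smul_add]
  | single n m =>
    induction n generalizing b m with
    | zero =>
      have h : ∀ x : S, singExp (T : S →ₗ[ℂ] S) (negx (Finsupp.single 0 x)) =
          Finsupp.single 0 (-x) := fun x => by
        simp [negx_single, singExp_single]
      rw [twistedMul, twistedMul, Finsupp.smul_single, h, Finsupp.smul_single, h, h,
        Finsupp.smul_single, h, Finsupp.smul_single]
      congr 1
      simp only [smul_eq_mul]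
      ring
    | succ n ih =>
      have h : Finsupp.single (n + 1) m =
          ddx (Finsupp.single n ((-((n : ℂ) + 1))⁻¹ • m)) := by
        have : -((n : ℂ) + 1) ≠ 0 := neg_ne_zero.mpr (by exact_mod_cast n.succ_ne_zero)
        rw [ddx_single, smul_smul, mul_inv_cancel₀ this, one_smul]
      rw [h, ← ddx_smul, twistedMul_ddx, twistedMul_ddx, ih, ih, ddx_smul, smul_sub]

end DifferentialAlgebra

section SymmetricAlgebra

variable {M : Type*} [AddCommGroup M] [Module ℂ M]

local notation "𝒮" => SymmetricAlgebra ℂ M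

theorem derivation_ext {N : Type*} [AddCommGroup N] [Module ℂ N] [Module 𝒮 N]
    {d d' : Derivation ℂ 𝒮 N}
    (h : ∀ m, d (SymmetricAlgebra.ι ℂ M m) = d' (SymmetricAlgebra.ι ℂ M m)) : d = d' := by
  ext a
  induction a using SymmetricAlgebra.induction with
  | algebraMap r => rw [Derivation.map_algebraMap, Derivation.map_algebraMap]
  | ι m => exact h m
  | mul a b ha hb => rw [Derivation.leibniz, Derivation.leibniz, ha, hb]
  | add a b ha hb => rw [map_add, map_add, ha, hb]

theorem extendDer_add (f g : M →ₗ[ℂ] Polar 𝒮) : extendDer (f + g) = extendDer f + extendDer g :=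
  derivation_ext fun m => by simp [extendDer_ι]

theorem extendDer_smul (r : ℂ) (f : M →ₗ[ℂ] Polar 𝒮) : extendDer (r • f) = r • extendDer f :=
  derivation_ext fun m => by simp [extendDer_ι]

variable (T : Module.End ℂ M) (Y : M →ₗ[ℂ] M →ₗ[ℂ] Polar M)

/-- `tildeY` as a bilinear map. -/
def tildeYLin : M →ₗ[ℂ] 𝒮 →ₗ[ℂ] Polar 𝒮 :=
  LinearMap.mk₂ ℂ (fun u a => tildeY Y u a)
    (fun u v a => by
      rw [← Derivation.add_apply, tildeY, tildeY, tildeY, ← extendDer_add, map_add,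
        LinearMap.comp_add])
    (fun r u a => by
      rw [← Derivation.smul_apply, tildeY, tildeY, ← extendDer_smul, map_smul,
        LinearMap.comp_smul])
    (fun u a b => map_add _ a b)
    (fun r u a => (tildeY Y u : 𝒮 →ₗ[ℂ] Polar 𝒮).map_smul r a)

/-- The map `u ↦ Sing (e ^ (x 𝒟) Ỹ(u, -x) a)`, linear in `a`. -/
def symYGen : 𝒮 →ₗ[ℂ] M →ₗ[ℂ] Polar 𝒮 :=
  ((tildeYLin Y).compr₂ (singExp (symDer T : 𝒮 →ₗ[ℂ] 𝒮) ∘ₗ negx)).flip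

/-- The operation of `S(M)`: the coefficients of `symY T Y a` are the derivations that extend
`u ↦ Sing (e ^ (x 𝒟) Ỹ(u, -x) a)`. -/
def symY : 𝒮 →ₗ[ℂ] 𝒮 →ₗ[ℂ] Polar 𝒮 :=
  LinearMap.mk₂ ℂ (fun a b => extendDer (symYGen T Y a) b)
    (fun a b c => by rw [← Derivation.add_apply, ← extendDer_add, map_add])
    (fun r a b => by rw [← Derivation.smul_apply, ← extendDer_smul, map_smul])
    (fun a b c => map_add _ b c)
    (fun r a b => (extendDer (symYGen T Y a) : 𝒮 →ₗ[ℂ] Polar 𝒮).map_smul r b)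

theorem symY_apply (a b : 𝒮) : symY T Y a b = extendDer (symYGen T Y a) b := rfl

theorem symY_ι_right (a : 𝒮) (u : M) : symY T Y a (SymmetricAlgebra.ι ℂ M u) =
    singExp (symDer T : 𝒮 →ₗ[ℂ] 𝒮) (negx (tildeY Y u a)) := by
  rw [symY_apply, extendDer_ι]
  rfl

theorem symY_mul_right (a b c : 𝒮) :
    symY T Y a (b * c) = b • symY T Y a c + c • symY T Y a b := by
  simp only [symY_apply, Derivation.leibniz]

theorem symY_algebraMap_right (a : 𝒮) (r : ℂ) : symY T Y a (algebraMap ℂ 𝒮 r) = 0 := by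
  simp only [symY_apply, Derivation.map_algebraMap]

theorem mapPolar_ι_skew (f : Polar M) :
    singExp (symDer T : 𝒮 →ₗ[ℂ] 𝒮) (negx (mapPolar (SymmetricAlgebra.ι ℂ M) f)) =
      mapPolar (SymmetricAlgebra.ι ℂ M) (singExp T (negx f)) := by
  refine polar_ext fun z => ?_
  rw [evalNum_mapPolar, evalAt_skew (commute_algebraMap z _), evalAt_skew (commute_algebraMap z _),
    evalAt_mapPolar (P := -(algebraMap ℂ _ z + T)) _ (fun m => ?_), map_neg]
  simp only [LinearMap.neg_apply, LinearMap.add_apply, Module.algebraMap_end_apply, map_neg,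
    map_add, map_smul, Derivation.coeFn_coe, symDer_ι]

theorem mapPolar_ι_ddx (f : Polar M) :
    mapPolar (SymmetricAlgebra.ι ℂ M) (ddx f) = ddx (mapPolar (SymmetricAlgebra.ι ℂ M) f) := by
  refine polar_ext fun z => ?_
  simp only [evalNum_mapPolar, evalAt_ddx, Module.algebraMap_end_apply, map_neg, map_smul]

variable {T Y}

/-- The two descriptions of `Y₋(a, x) u` for generators `a` and `u` agree by skew symmetry
in `M`. -/
theorem symY_ι_left (hs : ∀ a b, Y a b = singExp T (negx (Y b a))) (u : M) (a : 𝒮) :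
    symY T Y (SymmetricAlgebra.ι ℂ M u) a = tildeY Y u a := by
  rw [symY_apply]
  congr 1
  refine derivation_ext fun v => ?_
  rw [← symY_apply, symY_ι_right, tildeY_ι, mapPolar_ι_skew, ← hs, tildeY_ι]

theorem tildeY_derivative (hT : ∀ a b, Y (T a) b = ddx (Y a b)) (u : M) (a : 𝒮) :
    tildeY Y (T u) a = ddx (tildeY Y u a) := by
  induction a using SymmetricAlgebra.induction with
  | algebraMap r => rw [Derivation.map_algebraMap, Derivation.map_algebraMap, map_zero]
  | ι m => rw [tildeY_ι, tildeY_ι, hT, mapPolar_ι_ddx]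
  | mul a b ha hb =>
    rw [Derivation.leibniz, Derivation.leibniz, ha, hb, map_add, ddx_smul, ddx_smul]
  | add a b ha hb => rw [map_add, map_add, ha, hb, map_add]

theorem symY_derivative_right (hT : ∀ a b, Y (T a) b = ddx (Y a b)) (a b : 𝒮) :
    symY T Y a (symDer T b) =
      mapPolar (symDer T : 𝒮 →ₗ[ℂ] 𝒮) (symY T Y a b) - ddx (symY T Y a b) := by
  induction b using SymmetricAlgebra.induction with
  | algebraMap r => simp [symY_algebraMap_right]
  | ι u => rw [symDer_ι, symY_ι_right, symY_ι_right, tildeY_derivative hT, skew_ddx]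
  | mul b c hb hc =>
    rw [Derivation.leibniz, map_add, smul_eq_mul, smul_eq_mul, symY_mul_right, symY_mul_right,
      symY_mul_right, hb, hc]
    simp only [map_add, mapPolar_derivation_smul, ddx_smul, smul_sub]
    abel
  | add b c hb hc =>
    simp only [map_add, hb, hc]
    abel

theorem symY_derivative_left (hT : ∀ a b, Y (T a) b = ddx (Y a b))
    (hs : ∀ a b, Y a b = singExp T (negx (Y b a))) (a b : 𝒮) :
    symY T Y (symDer T a) b = ddx (symY T Y a b) := by
  induction b using SymmetricAlgebra.induction with
  | algebraMap r => simp [symY_algebraMap_right]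
  | ι u =>
    rw [symY_ι_right, symY_ι_right, ← symY_ι_left hs, ← symY_ι_left hs, symY_derivative_right hT,
      skew_sub_ddx]
  | mul b c hb hc => rw [symY_mul_right, symY_mul_right, hb, hc, map_add, ddx_smul, ddx_smul]
  | add b c hb hc => simp only [map_add, hb, hc]

/-- The Leibniz rule in the left argument. Both sides are derivations in `c`, as twisted and
ordinary multiplications commute. -/
theorem symY_mul_left (a b c : 𝒮) : symY T Y (a * b) c =
    twistedMul (symDer T) a (symY T Y b c) + twistedMul (symDer T) b (symY T Y a c) := by
  induction c using SymmetricAlgebra.induction with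
  | algebraMap r => simp [symY_algebraMap_right, twistedMul]
  | ι u =>
    simp only [symY_ι_right, twistedMul, skew_skew, Derivation.leibniz, map_add]
  | mul c d hc hd =>
    simp only [symY_mul_right, twistedMul_add, twistedMul_smul, hc, hd, smul_add]
    abel
  | add c d hc hd =>
    simp only [map_add, hc, hd, twistedMul_add]
    abel

theorem symY_skew (hs : ∀ a b, Y a b = singExp T (negx (Y b a))) (a b : 𝒮) :
    symY T Y a b = singExp (symDer T : 𝒮 →ₗ[ℂ] 𝒮) (negx (symY T Y b a)) := by
  induction b using SymmetricAlgebra.induction with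
  | algebraMap r =>
    have h : symY T Y (algebraMap ℂ 𝒮 r) a = 0 := by
      rw [symY_apply]
      have : extendDer (symYGen T Y (algebraMap ℂ 𝒮 r)) = 0 := derivation_ext fun u => by
        rw [← symY_apply, symY_ι_right, Derivation.map_algebraMap]
        simp
      rw [this, Derivation.zero_apply]
    rw [h, symY_algebraMap_right]
    simp
  | ι u => rw [symY_ι_right, symY_ι_left hs]
  | mul b c hb hc =>
    rw [symY_mul_right, symY_mul_left, map_add, map_add, twistedMul, twistedMul, skew_skew,
      skew_skew, ← hb, ← hc]
  | add b c hb hc => simp only [map_add, LinearMap.add_apply, hb, hc]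

theorem symY_extends (hs : ∀ a b, Y a b = singExp T (negx (Y b a))) : Extends (symY T Y) Y :=
  fun u v => by rw [symY_ι_left hs, tildeY_ι]

theorem bracket_mul_right (z : ℂ) (a b c : 𝒮) : bracket (symY T Y) z a (b * c) =
    b * bracket (symY T Y) z a c + c * bracket (symY T Y) z a b := by
  simp only [bracket_apply, symY_mul_right, map_add, evalNum_smul]

theorem isVertexPoissonAlgebra_symY (h : IsVertexLieAlgebra T Y) :
    IsVertexPoissonAlgebra (symDer T) (symY T Y) where
  vertexLie := by
    refine isVertexLieAlgebra_of_generators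
      (symY_derivative_left h.derivative h.half_skew) (symY_skew h.half_skew)
      (Set.range (SymmetricAlgebra.ι ℂ M)) ?_ ?_
    · rintro _ ⟨u, rfl⟩ _ ⟨v, rfl⟩ _ ⟨w, rfl⟩ x y
      have hb : ∀ z a b, bracket (symY T Y) z (SymmetricAlgebra.ι ℂ M a)
          (SymmetricAlgebra.ι ℂ M b) = SymmetricAlgebra.ι ℂ M (bracket Y z a b) := fun z a b => by
        rw [bracket_apply, symY_extends h.half_skew, evalNum_mapPolar]
        rfl
      simp only [hb, ← map_sub, (jacobi_iff Y u v w).mpr (h.half_commutator u v w) x y]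
    · intro a b hab c
      induction c using SymmetricAlgebra.induction with
      | algebraMap r =>
        intro z w
        simp [bracket_apply, symY_algebraMap_right]
      | ι u => exact hab _ ⟨u, rfl⟩
      | mul c d hc hd =>
        intro z w
        simp only [bracket_mul_right, map_add, ← hc z w, ← hd z w]
        ring
      | add c d hc hd =>
        intro z w
        simp only [map_add, ← hc z w, ← hd z w]
        abel
  leibniz a b c n := by
    rw [symY_mul_right]
    simp only [Finsupp.add_apply, Finsupp.smul_apply, smul_eq_mul]
    ring

/-- The operator `a ↦ Y₋(a, x)` of a vertex Poisson algebra as a derivation with values in singular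
series. -/
def IsVertexPoissonAlgebra.derivation {S : Type*} [CommRing S] [Algebra ℂ S]
    {D : Derivation ℂ S S} {Z : S →ₗ[ℂ] S →ₗ[ℂ] Polar S} (h : IsVertexPoissonAlgebra D Z) (a : S) :
    Derivation ℂ S (Polar S) :=
  Derivation.mk' (Z a) fun b c => Finsupp.ext fun n => by
    simp only [h.leibniz, Finsupp.add_apply, Finsupp.smul_apply, smul_eq_mul]
    ring

theorem symY_unique {Z : 𝒮 →ₗ[ℂ] 𝒮 →ₗ[ℂ] Polar 𝒮} (hZ : IsVertexPoissonAlgebra (symDer T) Z)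
    (hY : Extends Z Y) :
    Z = symY T Y := by
  have h1 : ∀ u a, Z (SymmetricAlgebra.ι ℂ M u) a = tildeY Y u a := fun u a => by
    have : hZ.derivation (SymmetricAlgebra.ι ℂ M u) = tildeY Y u := derivation_ext fun v => by
      rw [tildeY_ι]
      exact hY u v
    exact DFunLike.congr_fun this a
  refine LinearMap.ext₂ fun a b => ?_
  have : hZ.derivation a = extendDer (symYGen T Y a) := derivation_ext fun u => by
    rw [← symY_apply, symY_ι_right, ← h1]
    exact hZ.vertexLie.half_skew a _
  exact DFunLike.congr_fun this b

theorem coeff_tildeY_iff (u : M) (δ : ℕ → Derivation ℂ 𝒮 𝒮) :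
    (∀ n v, δ n (SymmetricAlgebra.ι ℂ M v) = SymmetricAlgebra.ι ℂ M (Y u v n)) ↔
      ∀ n a, δ n a = tildeY Y u a n := by
  constructor
  · intro h n a
    have : δ n = (Finsupp.lapply n : Polar 𝒮 →ₗ[𝒮] 𝒮).compDer (tildeY Y u) :=
      derivation_ext fun v => by
        change _ = tildeY Y u (SymmetricAlgebra.ι ℂ M v) n
        rw [h, tildeY_ι]
        simp [mapPolar]
    rw [this]
    rfl
  · intro h n v
    rw [h, tildeY_ι]
    simp [mapPolar]

end SymmetricAlgebra
end VertexLie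

end

theorem theorem4p12 {A B : Type*} [AddCommGroup A] [Module ℂ A] [AddCommGroup B] [Module ℂ B]
    (V : VertexLie.OneTruncatedConformalAlgebra A B) :
    ∃ Y : V.QuotC →ₗ[ℂ] V.QuotC →ₗ[ℂ] VertexLie.Polar V.QuotC,
      (∀ f g : V.FreeC, Y (V.proj f) (V.proj g) = VertexLie.mapPolar V.proj (V.freeY f g)) ∧
      VertexLie.IsVertexLieAlgebra V.quotD Y ∧
      (∀ (u : V.QuotC)
        (δ : ℕ → Derivation ℂ (SymmetricAlgebra ℂ V.QuotC) (SymmetricAlgebra ℂ V.QuotC)),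
        (∀ n v, δ n (SymmetricAlgebra.ι ℂ V.QuotC v) = SymmetricAlgebra.ι ℂ V.QuotC (Y u v n)) ↔
          ∀ n a, δ n a = VertexLie.tildeY Y u a n) ∧
      ∃ Z : SymmetricAlgebra ℂ V.QuotC →ₗ[ℂ] SymmetricAlgebra ℂ V.QuotC →ₗ[ℂ]
          VertexLie.Polar (SymmetricAlgebra ℂ V.QuotC),
        VertexLie.IsVertexPoissonAlgebra (VertexLie.symDer V.quotD) Z ∧
        VertexLie.Extends Z Y ∧
        (∀ Z' : SymmetricAlgebra ℂ V.QuotC →ₗ[ℂ] SymmetricAlgebra ℂ V.QuotC →ₗ[ℂ]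
            VertexLie.Polar (SymmetricAlgebra ℂ V.QuotC),
          VertexLie.IsVertexPoissonAlgebra (VertexLie.symDer V.quotD) Z' →
          VertexLie.Extends Z' Y → Z' = Z) ∧
        (∀ (a : SymmetricAlgebra ℂ V.QuotC) (u : V.QuotC),
          Z a (SymmetricAlgebra.ι ℂ V.QuotC u) =
            VertexLie.singExp
              (VertexLie.symDer V.quotD : Module.End ℂ (SymmetricAlgebra ℂ V.QuotC))
              (VertexLie.negx (VertexLie.tildeY Y u a))) := by
  have h := V.isVertexLieAlgebra_quotY
  exact ⟨V.quotY, V.quotY_proj, h, VertexLie.coeff_tildeY_iff, VertexLie.symY V.quotD V.quotY,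
    VertexLie.isVertexPoissonAlgebra_symY h, VertexLie.symY_extends h.half_skew,
    fun _ => VertexLie.symY_unique, VertexLie.symY_ι_right V.quotD V.quotY⟩
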